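/- Let $\mathbb H$ be the skew field of quaternions, $\mathbb B=\{q\in\mathbb H:|q|<1\}$, and let $\mathcal D$ be the ring of everywhere convergent power series $f(q)=\sum_{n\ge 0} q^n a_n$, $a_n\in\mathbb H$ (the regular functions $\mathbb H\to\mathbb H$), with the regular product $f*g(q)=\sum_n q^n\sum_{k=0}^n a_kb_{n-k}$ for $g(q)=\sum_n q^nb_n$. Put $f^c(q)=\sum_n q^n\bar a_n$ and $f^s=f*f^c$. Let $\mathcal L$ be the division ring of left quotients $f^{-*}*g$ ($f,g\in\mathcal D$, $f\ne 0$) of $\mathcal D$; the quotient $f^{-*}*g$ is regarded as the function $q\mapsto f^s(q)^{-1}\,(f^c*g)(q)$, defined where $f^s(q)\neq 0$ for some representation of the quotient (the value does not depend on the representation). For $A=\begin{pmatrix}a&c\\ b&d\end{pmatrix}\in GL(2,\mathbb H)$ and $f\in\mathcal L$ put $f.A=(fc+d)^{-*}*(fa+b)$, and let $\mathcal F_A(q)=(qc+d)^{-*}*(qa+b)$ be the regular fractional transformation associated to $A$; let $\mathcal G=\{\mathcal F_A: A\in GL(2,\mathbb H)\}$. Let $SL(2,\mathbb H)$ be the group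 of quaternionic $2\times2$ matrices of Dieudonné determinant $1$, and $Sp(1,1)=\{C\in GL(2,\mathbb H):\overline C^{\,t}HC=H\}$ with $H=\begin{pmatrix}1&0\\0&-1\end{pmatrix}$. For every $A\in SL(2,\mathbb H)$ the following are equivalent: 1. $\mathcal F_A$ is defined on $\mathbb B$ and maps $\mathbb B$ onto itself, i.e. $\mathcal F_A(\mathbb B)=\mathbb B$; 2. $A\in Sp(1,1)$; 3. there exist $u\in\partial\mathbb B$ and $a\in\mathbb B$ such that $\mathcal F_A(q)=(1-q\bar a)^{-*}*(q-a)u$ for all $q\in\mathbb B$; 4. there exists exactly one pair $(u,a)\in\partial\mathbb B\times\mathbb B$ with the property in 3. Moreover, the set $\mathcal M=\{f\in\mathcal G: f \text{ is defined on } \mathbb B,\ f(\mathbb B)=\mathbb B\}$ of regular Moebius transformations is the orbit $\{\mathrm{id}.A: A\in Sp(1,1)\}$ of the identity function $\mathrm{id}(q)=q$ under $Sp(1,1)$. -/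

import Mathlib

open scoped Quaternion Matrix nonZeroDivisors

noncomputable section

namespace RegularQuaternionic

/-- The ring `(𝓓_∞, +, *)` of regular functions `ℍ → ℍ`, identified with the everywhere
convergent power series `∑ qⁿ aₙ` (coefficients on the right).  The indeterminate of `ℍ⟦X⟧` is
central, so the product of `ℍ⟦X⟧` is the regular product: `cₙ = ∑ₖ aₖ bₙ₋ₖ`. -/
def Entire : Subring (PowerSeries ℍ[ℝ]) where
  carrier := {f | ∀ q : ℍ[ℝ], Summable fun n : ℕ => q ^ n * PowerSeries.coeff n f}
  zero_mem' := fun q => by simp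
  one_mem' := fun q => by
    refine summable_of_ne_finset_zero (s := {0}) fun n hn => ?_
    have : n ≠ 0 := by simpa using hn
    simp [PowerSeries.coeff_one, this]
  add_mem' := fun {f g} hf hg q => by
    simpa [mul_add] using (hf q).add (hg q)
  neg_mem' := fun {f} hf q => by
    simpa using (hf q).neg
  mul_mem' := fun {f g} hf hg q => by
    have h := fun {f : PowerSeries ℍ[ℝ]}
      (hf : ∀ q : ℍ[ℝ], Summable fun n : ℕ => q ^ n * PowerSeries.coeff n f) =>
        summable_norm_iff.mpr (hf q)
    have h1 : Summable fun n => ‖‖q‖ ^ n * ‖PowerSeries.coeff n f‖‖ := by simpa using h hf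
    have h2 : Summable fun n => ‖‖q‖ ^ n * ‖PowerSeries.coeff n g‖‖ := by simpa using h hg
    refine Summable.of_norm_bounded
      (summable_norm_sum_mul_antidiagonal_of_summable_norm h1 h2).of_norm fun n => ?_
    rw [PowerSeries.coeff_mul, Finset.mul_sum]
    refine (norm_sum_le _ _).trans (Finset.sum_le_sum fun kl hkl => ?_)
    rw [← Finset.HasAntidiagonal.mem_antidiagonal.mp hkl, pow_add, norm_mul, norm_mul, norm_mul, norm_pow, norm_pow]
    exact le_of_eq (by ring)

/-- The `n`-th coefficient of the power series expansion. -/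
def coef (f : Entire) (n : ℕ) : ℍ[ℝ] := PowerSeries.coeff n f.1

/-- The value `f(q) = ∑ qⁿ aₙ`. -/
def value (f : Entire) (q : ℍ[ℝ]) : ℍ[ℝ] := ∑' n : ℕ, q ^ n * coef f n

theorem coef_ext {f g : Entire} (h : ∀ n, coef f n = coef g n) : f = g :=
  Subtype.ext (PowerSeries.ext h)

theorem coef_mul (f g : Entire) (n : ℕ) :
    coef (f * g) n = ∑ p ∈ Finset.HasAntidiagonal.antidiagonal n, coef f p.1 * coef g p.2 :=
  PowerSeries.coeff_mul n f.1 g.1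

theorem summable_value (f : Entire) (q : ℍ[ℝ]) :
    Summable fun n : ℕ => ‖q ^ n * coef f n‖ :=
  summable_norm_iff.mpr (f.2 q)

/-- The constant function `a`. -/
def const (a : ℍ[ℝ]) : Entire :=
  ⟨PowerSeries.C a, fun q => by
    refine summable_of_ne_finset_zero (s := {0}) fun n hn => ?_
    have : n ≠ 0 := by simpa using hn
    simp [PowerSeries.coeff_C, this]⟩

/-- The identity function `q ↦ q`. -/
def ident : Entire :=
  ⟨PowerSeries.X, fun q => by
    refine summable_of_ne_finset_zero (s := {1}) fun n hn => ?_
    have : n ≠ 1 := by simpa using hn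
    simp [PowerSeries.coeff_X, this]⟩

/-- The regular conjugate `fᶜ(q) = ∑ qⁿ āₙ`. -/
def conj (f : Entire) : Entire :=
  ⟨PowerSeries.mk fun n => star (coef f n), fun q => by
    refine Summable.of_norm ?_
    simpa using summable_value f q⟩

/-- The symmetrization `fˢ = f * fᶜ`. -/
def symm (f : Entire) : Entire := f * conj f

@[simp] theorem coef_conj (f : Entire) (n : ℕ) : coef (conj f) n = star (coef f n) :=
  PowerSeries.coeff_mk n fun n => star (coef f n)

theorem conj_mul (f g : Entire) : conj (f * g) = conj g * conj f := by
  refine coef_ext fun n => ?_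
  rw [coef_conj, coef_mul, coef_mul, star_sum, ← Finset.Nat.sum_antidiagonal_swap]
  simp

theorem conj_conj (f : Entire) : conj (conj f) = f := coef_ext fun n => by simp

theorem star_coef_symm (f : Entire) (n : ℕ) : star (coef (symm f) n) = coef (symm f) n := by
  rw [← coef_conj, symm, conj_mul, conj_conj]

theorem coef_symm_comm (f : Entire) (n : ℕ) (a : ℍ[ℝ]) : Commute (coef (symm f) n) a := by
  rw [Quaternion.star_eq_self.mp (star_coef_symm f n)]
  exact Quaternion.coe_commute _ a

theorem symm_comm (f g : Entire) : symm f * g = g * symm f := by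
  refine coef_ext fun n => ?_
  rw [coef_mul, coef_mul, ← Finset.Nat.sum_antidiagonal_swap]
  exact Finset.sum_congr rfl fun p _ => (coef_symm_comm f _ _).eq

theorem conj_mul_self (f : Entire) : conj f * f = symm f := by
  by_cases hf : f = 0
  · subst hf; simp [symm]
  · refine mul_left_cancel₀ hf ?_
    rw [← symm_comm f f, symm, mul_assoc]

theorem conj_ne_zero {f : Entire} (hf : f ≠ 0) : conj f ≠ 0 := fun h => hf <| by
  refine coef_ext fun n => star_eq_zero.mp ?_
  rw [← coef_conj, h]
  exact map_zero (PowerSeries.coeff n)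

theorem symm_ne_zero {f : Entire} (hf : f ≠ 0) : symm f ≠ 0 :=
  mul_ne_zero hf (conj_ne_zero hf)

/-- The Ore condition `fˢ * g = (g * fᶜ) * f`. -/
instance : OreLocalization.OreSet (nonZeroDivisors Entire) :=
  OreLocalization.oreSetOfNoZeroDivisors
    (fun g f => g * conj f.1)
    (fun _ f => ⟨symm f.1, mem_nonZeroDivisors_of_ne_zero
      (symm_ne_zero (nonZeroDivisors.ne_zero f.2))⟩)
    (fun g f => by
      change symm f.1 * g = g * conj f.1 * f.1
      rw [mul_assoc, conj_mul_self, symm_comm])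

/-- The division ring `𝓛_∞` of left regular quotients `f^{-*} * g`: the classical ring of left
quotients of `𝓓_∞`.  Its multiplication is `*` and its inverse is `(·)^{-*}`. -/
abbrev RegQuot : Type := OreLocalization (nonZeroDivisors Entire) Entire

/-- The inclusion `𝓓_∞ → 𝓛_∞`. -/
abbrev toQuot : Entire →+* RegQuot := OreLocalization.numeratorRingHom

/-- `HasValue φ q w`: one can write `φ = f^{-*} * g` with `fˢ(q) ≠ 0` and
`w = fˢ(q)⁻¹ (fᶜ * g)(q)`. -/
def HasValue (φ : RegQuot) (q w : ℍ[ℝ]) : Prop :=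
  ∃ f g : Entire, f ≠ 0 ∧ φ = (toQuot f)⁻¹ * toQuot g ∧ value (symm f) q ≠ 0 ∧
    w = (value (symm f) q)⁻¹ * value (conj f * g) q

theorem toQuot_injective : Function.Injective toQuot :=
  OreLocalization.numeratorHom_inj fun _ h => h.1

theorem value_symm_mul (f g : Entire) (q : ℍ[ℝ]) :
    value (symm f * g) q = value (symm f) q * value g q := by
  unfold value
  rw [tsum_mul_tsum_eq_tsum_sum_antidiagonal_of_summable_norm (summable_value _ q)
    (summable_value _ q)]
  refine tsum_congr fun n => ?_
  rw [coef_mul, Finset.mul_sum]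
  refine Finset.sum_congr rfl fun p hp => ?_
  rw [← Finset.HasAntidiagonal.mem_antidiagonal.mp hp, pow_add, mul_assoc, mul_assoc,
    ← mul_assoc (q ^ p.2), ← ((coef_symm_comm f p.1) (q ^ p.2)).eq, mul_assoc]

/-- The value of a regular quotient does not depend on the representation. -/
theorem HasValue.unique {φ : RegQuot} {q w w' : ℍ[ℝ]} (h : HasValue φ q w) (h' : HasValue φ q w') :
    w = w' := by
  obtain ⟨f, g, hf, rfl, hq, rfl⟩ := h
  obtain ⟨f', g', hf', he, hq', rfl⟩ := h'
  have key : ∀ {f g : Entire}, f ≠ 0 →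
      toQuot (symm f) * ((toQuot f)⁻¹ * toQuot g) = toQuot (conj f * g) := by
    intro f g hf
    have hf0 : toQuot f ≠ 0 := (map_ne_zero_iff _ toQuot_injective).mpr hf
    rw [← conj_mul_self, map_mul, map_mul, mul_assoc, mul_inv_cancel_left₀ hf0]
  have e : symm f' * (conj f * g) = symm f * (conj f' * g') := by
    apply toQuot_injective
    rw [map_mul, ← key hf, map_mul _ (symm f), ← key hf', ← he, ← mul_assoc (toQuot (symm f')),
      ← mul_assoc (toQuot (symm f)), ← map_mul, ← map_mul, symm_comm]
  have e' := congrArg (fun h => value h q) e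
  simp only [value_symm_mul] at e'
  have c : value (symm f) q * value (symm f') q = value (symm f') q * value (symm f) q := by
    rw [← value_symm_mul, symm_comm, value_symm_mul]
  rw [inv_mul_eq_iff_eq_mul₀ hq]
  refine mul_left_cancel₀ hq' ?_
  rw [e', ← mul_assoc, ← c, mul_assoc, mul_inv_cancel_left₀ hq']

/-- A regular quotient as a partial function on `ℍ`. -/
def toFun (φ : RegQuot) : ℍ[ℝ] →. ℍ[ℝ] := fun q => ⟨∃ w, HasValue φ q w, fun h => h.choose⟩

theorem mem_toFun {φ : RegQuot} {q w : ℍ[ℝ]} : w ∈ toFun φ q ↔ HasValue φ q w :=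
  ⟨fun ⟨h, e⟩ => e ▸ h.choose_spec, fun h => ⟨⟨w, h⟩, (Exists.choose_spec ⟨w, h⟩).unique h⟩⟩

/-- The open unit ball `𝔹`. -/
def unitBall : Set ℍ[ℝ] := Metric.ball 0 1

/-- `φ` is defined on the whole of `𝔹` and `φ(𝔹) = 𝔹`. -/
def MapsBallOnto (φ : RegQuot) : Prop :=
  unitBall ⊆ (toFun φ).Dom ∧ (toFun φ).image unitBall = unitBall

/-- The action `f.A = (f c + d)^{-*} * (f a + b)` of `A = (a c; b d)` on regular quotients. -/
def act (f : RegQuot) (A : Matrix.GeneralLinearGroup (Fin 2) ℍ[ℝ]) : RegQuot :=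
  (f * toQuot (const (A.1 0 1)) + toQuot (const (A.1 1 1)))⁻¹ *
    (f * toQuot (const (A.1 0 0)) + toQuot (const (A.1 1 0)))

/-- The regular fractional transformation `𝓕_A(q) = (q c + d)^{-*} * (q a + b)` of
`A = (a c; b d)`. -/
def regFrac (A : Matrix.GeneralLinearGroup (Fin 2) ℍ[ℝ]) : RegQuot :=
  (toQuot (ident * const (A.1 0 1) + const (A.1 1 1)))⁻¹ *
    toQuot (ident * const (A.1 0 0) + const (A.1 1 0))

/-- The set `𝓖` of regular fractional transformations. -/
def regFracs : Set RegQuot := Set.range regFrac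

/-- The set `𝓜` of regular Moebius transformations. -/
def regMoebius : Set RegQuot := {φ ∈ regFracs | MapsBallOnto φ}

/-- The regular quotient `(1 - q ā)^{-*} * (q - a) u`. -/
def moebius (a u : ℍ[ℝ]) : RegQuot :=
  (toQuot (1 - ident * const (star a)))⁻¹ * toQuot ((ident - const a) * const u)

/-- The Dieudonné determinant of a quaternionic `2 × 2` matrix `(x y; z w)`, with values in
`[0, ∞)`: the norm of `x w - x z x⁻¹ y` if `x ≠ 0`, and of `z y` if `x = 0`. -/
def dieudonneDet (M : Matrix (Fin 2) (Fin 2) ℍ[ℝ]) : ℝ :=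
  open Classical in
  if M 0 0 = 0 then ‖M 1 0 * M 0 1‖
  else ‖M 0 0 * M 1 1 - M 0 0 * M 1 0 * (M 0 0)⁻¹ * M 0 1‖

/-- `SL(2, ℍ)`: the invertible matrices with Dieudonné determinant `1`. -/
def SL2 : Set (Matrix.GeneralLinearGroup (Fin 2) ℍ[ℝ]) := {A | dieudonneDet A.1 = 1}

/-- The matrix `H = diag(1, -1)`. -/
def formH : Matrix (Fin 2) (Fin 2) ℍ[ℝ] := !![1, 0; 0, -1]

/-- The symplectic group `Sp(1,1)` of all `C ∈ GL(2, ℍ)` with `C̄ᵗ H C = H`. -/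
def Sp11 : Subgroup (Matrix.GeneralLinearGroup (Fin 2) ℍ[ℝ]) where
  carrier := {C | C.1ᴴ * formH * C.1 = formH}
  one_mem' := by simp
  mul_mem' := fun {A B} hA hB => by
    change (A.1 * B.1)ᴴ * formH * (A.1 * B.1) = formH
    have hA' : A.1ᴴ * formH * A.1 = formH := hA
    have hB' : B.1ᴴ * formH * B.1 = formH := hB
    calc (A.1 * B.1)ᴴ * formH * (A.1 * B.1) = B.1ᴴ * (A.1ᴴ * formH * A.1) * B.1 := by
          rw [Matrix.conjTranspose_mul]; simp only [mul_assoc]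
      _ = formH := by rw [hA', hB']
  inv_mem' := fun {A} hA => by
    change (A⁻¹).1ᴴ * formH * (A⁻¹).1 = formH
    have hA' : A.1ᴴ * formH * A.1 = formH := hA
    have h1 : A.1 * (A⁻¹).1 = 1 := A.mul_inv
    have h2 : (A⁻¹).1ᴴ * A.1ᴴ = 1 := by rw [← Matrix.conjTranspose_mul, h1]; simp
    calc (A⁻¹).1ᴴ * formH * (A⁻¹).1 = (A⁻¹).1ᴴ * (A.1ᴴ * formH * A.1) * (A⁻¹).1 := by rw [hA']
      _ = ((A⁻¹).1ᴴ * A.1ᴴ) * formH * (A.1 * (A⁻¹).1) := by simp only [mul_assoc]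
      _ = formH := by rw [h1, h2, one_mul, mul_one]

/-- The orbit of `f` under the subgroup `Γ`. -/
def orbit (f : RegQuot) (Γ : Subgroup (Matrix.GeneralLinearGroup (Fin 2) ℍ[ℝ])) : Set RegQuot :=
  {φ | ∃ A ∈ Γ, φ = act f A}

end RegularQuaternionic

end

open RegularQuaternionic

/-! The regular product satisfies `(f * g)(q) = f(q) g(f(q)⁻¹ q f(q))` wherever `f(q) ≠ 0`.
Consequently the regular quotient `f^{-*} * g` takes at `q` the value `f(p)⁻¹ g(p)` of the pointwise
quotient at the conjugate `p = T_f(q) = fᶜ(q)⁻¹ q fᶜ(q)` of `q`. If neither `f` nor `fᶜ` vanishes on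
the ball, `T_f` is a bijection of the ball, with inverse `T_{fᶜ}`, so that `F_A` maps the ball onto
itself if and only if the classical transformation `p ↦ (p c + d)⁻¹ (p a + b)` does. That happens
exactly when the quadratic function `|p a + b|² - |p c + d|²` is negative on the ball and nowhere
else. This forces it to be a positive multiple `l (|p|² - 1)`, which says that `A` multiplies the
Hermitian form `H` by `l > 0`. Such an `l` is the Dieudonné determinant of `A`, so `l = 1` on
`SL(2, ℍ)`. Finally, the parameters of a Moebius transformation can be read off its values: `a` is
its only zero, and `u` is then determined by the value at any other point. -/

noncomputable section

namespace RegularQuaternionic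

section RegularProduct

variable {f g : Entire} {p q : ℍ[ℝ]}

theorem tsum_sum_antidiagonal {A α : Type*} [AddCommMonoid A] [Finset.HasAntidiagonal A]
    [AddCommGroup α] [UniformSpace α] [IsUniformAddGroup α] [CompleteSpace α] [T2Space α]
    {F : A × A → α} (hF : Summable F) :
    ∑' n, ∑ x ∈ Finset.HasAntidiagonal.antidiagonal n, F x = ∑' x, F x := by
  let e := Finset.HasAntidiagonal.sigmaAntidiagonalEquivProd (A := A)
  rw [← e.tsum_eq F]
  have hsigma : Summable fun c => F (e c) := e.summable_iff.mpr hF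
  refine Eq.trans (tsum_congr fun n => ?_) hsigma.tsum_sigma.symm
  rw [tsum_fintype]
  exact (Finset.sum_coe_sort _ F).symm

theorem summable_pow_mul_coef (f : Entire) (q : ℍ[ℝ]) : Summable fun n => q ^ n * coef f n :=
  f.2 q

theorem summable_pow_add_mul_coef_mul_coef (f g : Entire) (q : ℍ[ℝ]) :
    Summable fun x : ℕ × ℕ => q ^ (x.1 + x.2) * (coef f x.1 * coef g x.2) := by
  refine .of_norm (((summable_value f q).mul_of_nonneg (summable_value g q)
    (fun _ => norm_nonneg _) fun _ => norm_nonneg _).congr fun x => ?_)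
  simp only [norm_mul, norm_pow, pow_add]
  ring

theorem value_mul_eq_tsum_tsum (f g : Entire) (q : ℍ[ℝ]) :
    value (f * g) q = ∑' n, ∑' m, q ^ (m + n) * (coef f m * coef g n) := by
  have hsum := summable_pow_add_mul_coef_mul_coef f g q
  calc value (f * g) q
      = ∑' k, ∑ x ∈ Finset.HasAntidiagonal.antidiagonal k,
          q ^ (x.1 + x.2) * (coef f x.1 * coef g x.2) := by
        refine tsum_congr fun k => ?_
        rw [coef_mul, Finset.mul_sum]
        refine Finset.sum_congr rfl fun x hx => ?_
        rw [Finset.HasAntidiagonal.mem_antidiagonal.mp hx]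
    _ = ∑' x : ℕ × ℕ, q ^ (x.1 + x.2) * (coef f x.1 * coef g x.2) := tsum_sum_antidiagonal hsum
    _ = ∑' n, ∑' m, q ^ (m + n) * (coef f m * coef g n) := by
        rw [← (Equiv.prodComm ℕ ℕ).tsum_eq]
        exact hsum.prod_symm.tsum_prod

/-- Away from the zeros of `f`, the only `p` allowed is `f(q)⁻¹ q f(q)`. -/
theorem value_mul (h : SemiconjBy (value f q) p q) :
    value (f * g) q = value f q * value g p := by
  have inner_sum (n : ℕ) :
      ∑' m, q ^ (m + n) * (coef f m * coef g n) = value f q * (p ^ n * coef g n) := by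
    rw [← mul_assoc, (h.pow_right n).eq, value, ← (summable_pow_mul_coef f q).tsum_mul_left,
      ← ((summable_pow_mul_coef f q).mul_left _).tsum_mul_right]
    exact tsum_congr fun m => by simp only [add_comm m, pow_add, mul_assoc]
  rw [value_mul_eq_tsum_tsum, tsum_congr inner_sum, (summable_pow_mul_coef g p).tsum_mul_left,
    ← value]

theorem value_zero (q : ℍ[ℝ]) : value 0 q = 0 := by
  simp [value, coef]

theorem ne_zero_of_value_ne_zero (h : value f q ≠ 0) : f ≠ 0 := by
  rintro rfl
  exact h (value_zero q)

theorem coef_add (f g : Entire) (n : ℕ) : coef (f + g) n = coef f n + coef g n :=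
  map_add (PowerSeries.coeff n) f.1 g.1

theorem coef_const (a : ℍ[ℝ]) (n : ℕ) : coef (const a) n = if n = 0 then a else 0 :=
  PowerSeries.coeff_C n a

theorem coef_ident (n : ℕ) : coef ident n = if n = 1 then 1 else 0 :=
  PowerSeries.coeff_X n

theorem value_add (f g : Entire) (q : ℍ[ℝ]) : value (f + g) q = value f q + value g q := by
  rw [value, value, value, ← (summable_pow_mul_coef f q).tsum_add (summable_pow_mul_coef g q)]
  exact tsum_congr fun n => by rw [coef_add, mul_add]

theorem value_const (a q : ℍ[ℝ]) : value (const a) q = a := by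
  simp only [value, coef_const, mul_ite, mul_zero, tsum_ite_eq, pow_zero, one_mul]

theorem value_ident (q : ℍ[ℝ]) : value ident q = q := by
  simp only [value, coef_ident, mul_ite, mul_zero, tsum_ite_eq, pow_one, mul_one]

theorem value_ident_mul (f : Entire) (q : ℍ[ℝ]) : value (ident * f) q = q * value f q := by
  rw [value_mul (p := q) (by rw [value_ident]; exact Commute.refl q), value_ident]

theorem mul_ident (f : Entire) : f * ident = ident * f :=
  Subtype.ext (PowerSeries.commute_X f.1).eq

theorem commute_value_symm (f : Entire) (q : ℍ[ℝ]) : Commute (value (symm f) q) q :=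
  calc value (symm f) q * q = value (symm f * ident) q := by rw [value_symm_mul, value_ident]
    _ = q * value (symm f) q := by rw [mul_ident, value_ident_mul]

end RegularProduct

section Twist

variable {f : Entire} {p q : ℍ[ℝ]}

/-- The transformation `T_f(q) = fᶜ(q)⁻¹ q fᶜ(q)`, which reduces regular quotients to pointwise
ones: `(f^{-*} * g)(q) = f(T_f(q))⁻¹ g(T_f(q))`. -/
def twist (f : Entire) (q : ℍ[ℝ]) : ℍ[ℝ] := (value (conj f) q)⁻¹ * q * value (conj f) q

theorem semiconjBy_twist (hq : value (conj f) q ≠ 0) :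
    SemiconjBy (value (conj f) q) (twist f q) q := by
  rw [SemiconjBy, twist, ← mul_assoc, mul_inv_cancel_left₀ hq]

theorem twist_eq_of_semiconjBy (hq : value (conj f) q ≠ 0)
    (h : SemiconjBy (value (conj f) q) p q) : twist f q = p := by
  rw [twist, mul_assoc, ← h.eq, inv_mul_cancel_left₀ hq]

theorem norm_twist (hq : value (conj f) q ≠ 0) : ‖twist f q‖ = ‖q‖ := by
  rw [twist, norm_mul, norm_mul, norm_inv, mul_right_comm,
    inv_mul_cancel₀ (norm_ne_zero_iff.mpr hq), one_mul]

theorem value_symm_eq_mul_value_twist (hq : value (conj f) q ≠ 0) :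
    value (symm f) q = value (conj f) q * value f (twist f q) := by
  rw [← conj_mul_self, value_mul (semiconjBy_twist hq)]

theorem twist_conj_twist (hq : value (conj f) q ≠ 0) (hp : value f (twist f q) ≠ 0) :
    twist (conj f) (twist f q) = q := by
  set p := twist f q
  have hcomm := (commute_value_symm f q).eq
  rw [value_symm_eq_mul_value_twist hq] at hcomm
  refine twist_eq_of_semiconjBy (by rwa [conj_conj]) (mul_left_cancel₀ hq ?_)
  rw [conj_conj, ← mul_assoc, hcomm, ← mul_assoc, ← (semiconjBy_twist hq).eq, mul_assoc]

theorem mem_unitBall_iff : q ∈ unitBall ↔ ‖q‖ < 1 :=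
  mem_ball_zero_iff

theorem twist_mem_unitBall (hfc : ∀ q ∈ unitBall, value (conj f) q ≠ 0) (hq : q ∈ unitBall) :
    twist f q ∈ unitBall := by
  rwa [mem_unitBall_iff, norm_twist (hfc q hq), ← mem_unitBall_iff]

theorem image_twist_unitBall (hf : ∀ q ∈ unitBall, value f q ≠ 0)
    (hfc : ∀ q ∈ unitBall, value (conj f) q ≠ 0) : twist f '' unitBall = unitBall := by
  have hfcc : ∀ q ∈ unitBall, value (conj (conj f)) q ≠ 0 := by rwa [conj_conj]
  refine Set.Subset.antisymm (Set.image_subset_iff.mpr fun q => twist_mem_unitBall hfc)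
    fun p hp => ?_
  have hq := twist_mem_unitBall hfcc hp
  refine ⟨twist (conj f) p, hq, ?_⟩
  simpa only [conj_conj] using twist_conj_twist (hfcc p hp) (hfc _ hq)

theorem injOn_twist_unitBall (hf : ∀ q ∈ unitBall, value f q ≠ 0)
    (hfc : ∀ q ∈ unitBall, value (conj f) q ≠ 0) : Set.InjOn (twist f) unitBall :=
  Set.LeftInvOn.injOn (f₁' := twist (conj f)) fun q hq =>
    twist_conj_twist (hfc q hq) (hf _ (twist_mem_unitBall hfc hq))

end Twist

section RegularQuotient

variable {f g : Entire} {q w : ℍ[ℝ]} {φ ψ : RegQuot}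

theorem toQuot_ne_zero (hf : f ≠ 0) : toQuot f ≠ 0 :=
  (map_ne_zero_iff _ toQuot_injective).mpr hf

theorem hasValue_inv_mul (g : Entire) (hq : value (conj f) q ≠ 0) (hp : value f (twist f q) ≠ 0) :
    HasValue ((toQuot f)⁻¹ * toQuot g) q
      ((value f (twist f q))⁻¹ * value g (twist f q)) := by
  have hs := value_symm_eq_mul_value_twist hq
  refine ⟨f, g, ne_zero_of_value_ne_zero hp, rfl, hs ▸ mul_ne_zero hq hp, ?_⟩
  rw [hs, value_mul (semiconjBy_twist hq), mul_inv_rev, mul_assoc, inv_mul_cancel_left₀ hq]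

theorem HasValue.value_eq_zero (hf : f ≠ 0) (h : HasValue ((toQuot f)⁻¹ * toQuot g) q w)
    (hq : value f q = 0) : value g q = 0 := by
  obtain ⟨f', g', hf', hquot, hs, -⟩ := h
  have hcross : symm f' * g = f * (conj f' * g') := by
    apply toQuot_injective
    have hg : toQuot g = toQuot f * ((toQuot f')⁻¹ * toQuot g') := by
      rw [← hquot, mul_inv_cancel_left₀ (toQuot_ne_zero hf)]
    rw [map_mul, hg, ← mul_assoc, ← map_mul, symm_comm, ← conj_mul_self, ← mul_assoc f, map_mul,
      mul_assoc, mul_inv_cancel_left₀ (toQuot_ne_zero hf'), ← map_mul, mul_assoc]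
  have hval : value (symm f') q * value g q = 0 := by
    rw [← value_symm_mul, hcross, value_mul (p := 0) (by simp [SemiconjBy, hq]), hq, zero_mul]
  exact (mul_eq_zero.mp hval).resolve_left hs

theorem HasValue.mem_dom (h : HasValue φ q w) : q ∈ (toFun φ).Dom :=
  (PFun.mem_dom _ _).mpr ⟨w, mem_toFun.mpr h⟩

theorem MapsBallOnto.congr (hφ : MapsBallOnto φ)
    (h : ∀ q ∈ unitBall, ∃ w, w ∈ toFun ψ q ∧ w ∈ toFun φ q) : MapsBallOnto ψ := by
  have heq : ∀ q ∈ unitBall, toFun ψ q = toFun φ q := fun q hq => by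
    obtain ⟨w, hψ, hφ⟩ := h q hq
    rw [Part.eq_some_iff.mpr hψ, Part.eq_some_iff.mpr hφ]
  refine ⟨fun q hq => ?_, Eq.trans (Set.ext fun w => ?_) hφ.2⟩
  · obtain ⟨w, hψ, -⟩ := h q hq
    exact (mem_toFun.mp hψ).mem_dom
  · simp only [PFun.mem_image]
    exact exists_congr fun q => and_congr_right fun hq => by rw [heq q hq]

theorem mapsBallOnto_inv_mul_iff (hf : ∀ q ∈ unitBall, value f q ≠ 0)
    (hfc : ∀ q ∈ unitBall, value (conj f) q ≠ 0) :
    MapsBallOnto ((toQuot f)⁻¹ * toQuot g) ↔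
      (fun p => (value f p)⁻¹ * value g p) '' unitBall = unitBall := by
  have hval : ∀ q ∈ unitBall, HasValue ((toQuot f)⁻¹ * toQuot g) q
      ((value f (twist f q))⁻¹ * value g (twist f q)) := fun q hq =>
    hasValue_inv_mul g (hfc q hq) (hf _ (twist_mem_unitBall hfc hq))
  have himage : (toFun ((toQuot f)⁻¹ * toQuot g)).image unitBall =
      (fun p => (value f p)⁻¹ * value g p) '' unitBall := by
    rw [← image_twist_unitBall hf hfc, Set.image_image, image_twist_unitBall hf hfc]
    ext w
    refine exists_congr fun q => and_congr_right fun hq => ?_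
    exact mem_toFun.trans ⟨fun h => (hval q hq).unique h, fun h => h ▸ hval q hq⟩
  rw [MapsBallOnto, himage]
  exact and_iff_right fun q hq => (hval q hq).mem_dom

end RegularQuotient

section FractionalTransformation

variable {K : Type*} [DivisionRing K] {M N : Matrix (Fin 2) (Fin 2) K} {p : K}

/-- The numerator `p a + b` of the fractional transformation of the matrix `(a c; b d)`. -/
def num (M : Matrix (Fin 2) (Fin 2) K) (p : K) : K := p * M 0 0 + M 1 0

/-- The denominator `p c + d` of the fractional transformation of the matrix `(a c; b d)`. -/
def denom (M : Matrix (Fin 2) (Fin 2) K) (p : K) : K := p * M 0 1 + M 1 1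

/-- The classical (pointwise) fractional transformation `p ↦ (p c + d)⁻¹ (p a + b)` of the matrix
`(a c; b d)`. Rows act from the left, so matrices act on points from the right: `frac (M * N)` is
`frac N ∘ frac M`. -/
def frac (M : Matrix (Fin 2) (Fin 2) K) (p : K) : K := (denom M p)⁻¹ * num M p

theorem denom_mul_frac (hp : denom M p ≠ 0) : denom M p * frac M p = num M p :=
  mul_inv_cancel_left₀ hp _

theorem num_mul (hp : denom M p ≠ 0) : num (M * N) p = denom M p * num N (frac M p) := by
  rw [num, num, mul_add, ← mul_assoc, denom_mul_frac hp]
  simp only [num, denom, Matrix.mul_apply, Fin.sum_univ_two]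
  noncomm_ring

theorem denom_mul (hp : denom M p ≠ 0) : denom (M * N) p = denom M p * denom N (frac M p) := by
  rw [denom, denom.eq_def N, mul_add, ← mul_assoc, denom_mul_frac hp]
  simp only [num, denom, Matrix.mul_apply, Fin.sum_univ_two]
  noncomm_ring

theorem frac_mul (hp : denom M p ≠ 0) : frac (M * N) p = frac N (frac M p) := by
  rw [frac, num_mul hp, denom_mul hp, mul_inv_rev, mul_assoc, inv_mul_cancel_left₀ hp,
    ← frac]

theorem frac_one (p : K) : frac 1 p = p := by
  simp [frac, num, denom]

theorem injOn_frac (hM : IsUnit M) : Set.InjOn (frac M) {p | denom M p ≠ 0} := by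
  obtain ⟨N, hMN⟩ := hM.exists_right_inv
  exact Set.LeftInvOn.injOn (f₁' := frac N) fun p hp => by rw [← frac_mul hp, hMN, frac_one]

theorem num_ne_zero_of_denom_eq_zero (hM : IsUnit M) (hp : denom M p = 0) : num M p ≠ 0 := by
  obtain ⟨N, hMN⟩ := hM.exists_right_inv
  intro hnum
  have hrow : num M p * N 0 1 + denom M p * N 1 1 = denom (M * N) p := by
    simp only [num, denom, Matrix.mul_apply, Fin.sum_univ_two]
    noncomm_ring
  rw [hnum, hp, hMN] at hrow
  simp [denom] at hrow

end FractionalTransformation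

section LinearQuotient

variable {M : Matrix (Fin 2) (Fin 2) ℍ[ℝ]} {p q x y z : ℍ[ℝ]}

/-- The linear regular function `q ↦ q x + y`. -/
def linear (x y : ℍ[ℝ]) : Entire := ident * const x + const y

/-- The regular fractional transformation `(q c + d)^{-*} * (q a + b)` of a matrix `(a c; b d)`
which need not be invertible; it extends `regFrac`. -/
def fracQuot (M : Matrix (Fin 2) (Fin 2) ℍ[ℝ]) : RegQuot :=
  (toQuot (linear (M 0 1) (M 1 1)))⁻¹ * toQuot (linear (M 0 0) (M 1 0))

theorem regFrac_eq_fracQuot (A : Matrix.GeneralLinearGroup (Fin 2) ℍ[ℝ]) :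
    regFrac A = fracQuot A.1 := rfl

theorem act_ident (A : Matrix.GeneralLinearGroup (Fin 2) ℍ[ℝ]) :
    act (toQuot ident) A = regFrac A := by
  simp only [act, regFrac, map_add, map_mul]

theorem const_neg (x : ℍ[ℝ]) : const (-x) = -const x :=
  Subtype.ext (map_neg PowerSeries.C x)

theorem const_one : const 1 = 1 :=
  Subtype.ext (map_one PowerSeries.C)

theorem const_mul (x y : ℍ[ℝ]) : const (x * y) = const x * const y :=
  Subtype.ext (map_mul PowerSeries.C x y)

theorem conj_add (f g : Entire) : conj (f + g) = conj f + conj g :=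
  coef_ext fun n => by simp only [coef_conj, coef_add, star_add]

theorem conj_const (x : ℍ[ℝ]) : conj (const x) = const (star x) :=
  coef_ext fun n => by simp only [coef_conj, coef_const, apply_ite star, star_zero]

theorem conj_ident : conj ident = ident :=
  coef_ext fun n => by simp only [coef_conj, coef_ident, apply_ite star, star_zero, star_one]

theorem conj_linear (x y : ℍ[ℝ]) : conj (linear x y) = linear (star x) (star y) := by
  simp only [linear, conj_add, conj_mul, conj_const, conj_ident, mul_ident]

theorem value_linear (x y q : ℍ[ℝ]) : value (linear x y) q = q * x + y := by
  simp only [linear, value_add, value_ident_mul, value_const]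

theorem const_mul_linear (x y z : ℍ[ℝ]) :
    const z * linear x y = linear (z * x) (z * y) := by
  simp only [linear, mul_add, ← mul_assoc, mul_ident, const_mul]

theorem linear_ne_zero (h : x ≠ 0 ∨ y ≠ 0) : linear x y ≠ 0 := by
  intro hlin
  have hval (q : ℍ[ℝ]) : q * x + y = 0 := by rw [← value_linear, hlin, value_zero]
  have hy : y = 0 := by simpa only [zero_mul, zero_add] using hval 0
  have hx : x = 0 := by simpa only [hy, one_mul, add_zero] using hval 1
  exact h.elim (· hx) (· hy)

theorem fracQuot_smul (hz : z ≠ 0) (M : Matrix (Fin 2) (Fin 2) ℍ[ℝ]) :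
    fracQuot (z • M) = fracQuot M := by
  have hz' : toQuot (const z) ≠ 0 :=
    toQuot_ne_zero (ne_zero_of_value_ne_zero (q := 0) (by rwa [value_const]))
  simp only [fracQuot, Matrix.smul_apply, smul_eq_mul, ← const_mul_linear, map_mul, mul_inv_rev,
    mul_assoc, inv_mul_cancel_left₀ hz']

/-- If `c ≠ 0` and `q c̄ + d̄ = 0`, then `p = c q̄ c⁻¹` has the norm of `q` and `p c + d = 0`. -/
theorem mul_star_add_star_ne_zero (h : ∀ p ∈ unitBall, p * x + y ≠ 0) (hq : q ∈ unitBall) :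
    q * star x + star y ≠ 0 := by
  intro hzero
  have hzero' : x * star q + y = 0 := by simpa using congrArg star hzero
  rcases eq_or_ne x 0 with rfl | hx
  · exact h q hq (by simpa only [mul_zero, zero_mul] using hzero')
  · refine h (x * star q * x⁻¹) ?_ (by rwa [inv_mul_cancel_right₀ hx])
    rwa [mem_unitBall_iff, norm_mul, norm_mul, norm_inv, norm_star, mul_right_comm,
      mul_inv_cancel₀ (norm_ne_zero_iff.mpr hx), one_mul, ← mem_unitBall_iff]

theorem value_linear_ne_zero (h : ∀ p ∈ unitBall, denom M p ≠ 0) :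
    ∀ p ∈ unitBall, value (linear (M 0 1) (M 1 1)) p ≠ 0 := fun p hp => by
  rw [value_linear]
  exact h p hp

theorem value_conj_linear_ne_zero (h : ∀ p ∈ unitBall, denom M p ≠ 0) :
    ∀ q ∈ unitBall, value (conj (linear (M 0 1) (M 1 1))) q ≠ 0 := fun q hq => by
  rw [conj_linear, value_linear]
  exact mul_star_add_star_ne_zero h hq

theorem hasValue_fracQuot (h : ∀ p ∈ unitBall, denom M p ≠ 0) (hq : q ∈ unitBall) :
    HasValue (fracQuot M) q (frac M (twist (linear (M 0 1) (M 1 1)) q)) := by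
  have hvalue := hasValue_inv_mul (linear (M 0 0) (M 1 0)) (value_conj_linear_ne_zero h q hq)
    (value_linear_ne_zero h _ (twist_mem_unitBall (value_conj_linear_ne_zero h) hq))
  simp only [value_linear] at hvalue
  exact hvalue

theorem mapsBallOnto_fracQuot_iff (h : ∀ p ∈ unitBall, denom M p ≠ 0) :
    MapsBallOnto (fracQuot M) ↔ frac M '' unitBall = unitBall := by
  rw [fracQuot, mapsBallOnto_inv_mul_iff (value_linear_ne_zero h) (value_conj_linear_ne_zero h)]
  simp only [value_linear]
  rfl

theorem denom_ne_zero_of_mapsBallOnto (hM : IsUnit M) (h : MapsBallOnto (fracQuot M))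
    (hp : p ∈ unitBall) : denom M p ≠ 0 := by
  intro hdenom
  obtain ⟨w, hw⟩ := (PFun.mem_dom _ _).mp (h.1 hp)
  have hlinear : linear (M 0 1) (M 1 1) ≠ 0 := by
    obtain ⟨N, hNM⟩ := hM.exists_left_inv
    refine linear_ne_zero (not_and_or.mp fun hcol => ?_)
    simpa [Matrix.mul_apply, hcol.1, hcol.2] using congrFun₂ hNM 1 1
  refine num_ne_zero_of_denom_eq_zero hM hdenom ?_
  have := (mem_toFun.mp hw).value_eq_zero hlinear (by rwa [value_linear])
  rwa [value_linear] at this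

end LinearQuotient

section QuadraticFunction

variable {E : Type*} [NormedAddCommGroup E] [InnerProductSpace ℝ E] {k n : ℝ} {m p : E}

theorem add_inner_add_eq_zero_of_norm_eq_one
    (h : ∀ p : E, ‖p‖ < 1 ↔ k * ‖p‖ ^ 2 + 2 * inner ℝ m p + n < 0) (hp : ‖p‖ = 1) :
    k + 2 * inner ℝ m p + n = 0 := by
  have hcont : Continuous fun p : E => k * ‖p‖ ^ 2 + 2 * inner ℝ m p + n := by fun_prop
  have hclosure : p ∈ closure (Metric.ball (0 : E) 1) := by
    rw [closure_ball _ one_ne_zero, mem_closedBall_zero_iff, hp]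
  have hle : k * ‖p‖ ^ 2 + 2 * inner ℝ m p + n ≤ 0 :=
    closure_minimal (t := {p | k * ‖p‖ ^ 2 + 2 * inner ℝ m p + n ≤ 0})
      (fun q hq => ((h q).mp (mem_ball_zero_iff.mp hq)).le)
      (isClosed_le hcont continuous_const) hclosure
  have hge : 0 ≤ k * ‖p‖ ^ 2 + 2 * inner ℝ m p + n := not_lt.mp fun hlt => ((h p).mpr hlt).ne hp
  simpa only [hp, one_pow, mul_one] using le_antisymm hle hge

theorem eq_neg_and_eq_zero_of_norm_lt_one_iff [Nontrivial E]
    (h : ∀ p : E, ‖p‖ < 1 ↔ k * ‖p‖ ^ 2 + 2 * inner ℝ m p + n < 0) :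
    n < 0 ∧ k = -n ∧ m = 0 := by
  have hn : n < 0 := by simpa using h 0
  have horth (p : E) (hp : ‖p‖ = 1) : k + n = 0 ∧ inner ℝ m p = 0 := by
    have hpos := add_inner_add_eq_zero_of_norm_eq_one h hp
    have hneg := add_inner_add_eq_zero_of_norm_eq_one h ((norm_neg p).trans hp)
    rw [inner_neg_right] at hneg
    constructor <;> linarith
  obtain ⟨e, he⟩ := exists_norm_eq E zero_le_one
  refine ⟨hn, eq_neg_of_add_eq_zero_left (horth e he).1, by_contra fun hm => ?_⟩
  have hinner := (horth _ (norm_smul_inv_norm (𝕜 := ℝ) hm)).2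
  rw [real_inner_smul_right, real_inner_self_eq_norm_sq] at hinner
  simp [hm] at hinner

end QuadraticFunction

section Similitude

variable {M N : Matrix (Fin 2) (Fin 2) ℍ[ℝ]} {l : ℝ} {p v w : ℍ[ℝ]}

/-- `M` multiplies the Hermitian form of `formH` by the real factor `l`; the group `Sp(1,1)`
consists of the similitudes with factor `1`. -/
def IsSimilitude (M : Matrix (Fin 2) (Fin 2) ℍ[ℝ]) (l : ℝ) : Prop :=
  Mᴴ * formH * M = l • formH

theorem mem_Sp11_iff {A : Matrix.GeneralLinearGroup (Fin 2) ℍ[ℝ]} :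
    A ∈ Sp11 ↔ IsSimilitude A.1 1 := by
  rw [IsSimilitude, one_smul]
  rfl

theorem formH_mul_formH : formH * formH = 1 := by
  ext i j : 1
  fin_cases i <;> fin_cases j <;> simp [formH, Matrix.mul_apply]

theorem star_mul_self_eq_coe_norm_sq (x : ℍ[ℝ]) : star x * x = ((‖x‖ ^ 2 : ℝ) : ℍ[ℝ]) := by
  rw [Quaternion.star_mul_self, Quaternion.normSq_eq_norm_mul_self, sq]

theorem conjTranspose_mul_formH_mul (M : Matrix (Fin 2) (Fin 2) ℍ[ℝ]) :
    Mᴴ * formH * M =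
      !![((‖M 0 0‖ ^ 2 - ‖M 1 0‖ ^ 2 : ℝ) : ℍ[ℝ]), star (M 0 0) * M 0 1 - star (M 1 0) * M 1 1;
        star (M 0 1) * M 0 0 - star (M 1 1) * M 1 0, ((‖M 0 1‖ ^ 2 - ‖M 1 1‖ ^ 2 : ℝ) : ℍ[ℝ])] := by
  simp only [Quaternion.coe_sub, ← star_mul_self_eq_coe_norm_sq]
  ext i j : 1
  fin_cases i <;> fin_cases j <;> simp [Matrix.mul_apply, formH, sub_eq_add_neg]

theorem isSimilitude_iff :
    IsSimilitude M l ↔ ‖M 0 0‖ ^ 2 - ‖M 1 0‖ ^ 2 = l ∧ ‖M 1 1‖ ^ 2 - ‖M 0 1‖ ^ 2 = l ∧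
      star (M 0 1) * M 0 0 = star (M 1 1) * M 1 0 := by
  have hsmul : l • formH = !![(l : ℍ[ℝ]), 0; 0, ((-l : ℝ) : ℍ[ℝ])] := by
    ext i j : 1
    fin_cases i <;> fin_cases j <;> simp [formH, ← Quaternion.mul_coe_eq_smul]
  have hstar : star (M 0 0) * M 0 1 = star (M 1 0) * M 1 1 ↔
      star (M 0 1) * M 0 0 = star (M 1 1) * M 1 0 := by
    rw [← star_inj]
    simp only [star_mul, star_star]
  rw [IsSimilitude, conjTranspose_mul_formH_mul, hsmul, ← neg_sub (‖M 1 1‖ ^ 2)]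
  simp only [← Matrix.ext_iff, Fin.forall_fin_two, Matrix.of_apply, Matrix.cons_val_zero,
    Matrix.cons_val_one, Matrix.cons_val', Matrix.cons_val_fin_one, Quaternion.coe_inj, neg_inj,
    sub_eq_zero, hstar]
  tauto

theorem IsSimilitude.inv_smul_mul_eq_one (hM : IsSimilitude M l) (hl : l ≠ 0) :
    l⁻¹ • (formH * Mᴴ * formH) * M = 1 :=
  calc l⁻¹ • (formH * Mᴴ * formH) * M = l⁻¹ • (formH * (Mᴴ * formH * M)) := by
        rw [smul_mul_assoc]
        simp only [mul_assoc]
    _ = l⁻¹ • (formH * l • formH) := congrArg (l⁻¹ • (formH * ·)) hM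
    _ = 1 := by rw [mul_smul_comm, formH_mul_formH, smul_smul, inv_mul_cancel₀ hl, one_smul]

theorem IsSimilitude.isUnit (hM : IsSimilitude M l) (hl : l ≠ 0) : IsUnit M :=
  .of_mul_eq_one_right _ (hM.inv_smul_mul_eq_one hl)

theorem IsSimilitude.conjTranspose (hM : IsSimilitude M l) (hl : l ≠ 0) : IsSimilitude Mᴴ l := by
  have hinv : M * (l⁻¹ • (formH * Mᴴ * formH)) = 1 :=
    mul_eq_one_comm.mp (hM.inv_smul_mul_eq_one hl)
  calc Mᴴᴴ * formH * Mᴴ = l • (M * (l⁻¹ • (formH * Mᴴ * formH)) * formH) := by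
        simp only [Matrix.conjTranspose_conjTranspose, mul_smul_comm, smul_mul_assoc, mul_assoc,
          formH_mul_formH, mul_one, smul_inv_smul₀ hl]
    _ = l • formH := by rw [hinv, one_mul]

theorem isSimilitude_conjTranspose_iff (hl : l ≠ 0) : IsSimilitude Mᴴ l ↔ IsSimilitude M l :=
  ⟨fun h => M.conjTranspose_conjTranspose ▸ h.conjTranspose hl, fun h => h.conjTranspose hl⟩

theorem isSimilitude_iff_rows (hl : l ≠ 0) :
    IsSimilitude M l ↔ ‖M 0 0‖ ^ 2 - ‖M 0 1‖ ^ 2 = l ∧ ‖M 1 1‖ ^ 2 - ‖M 1 0‖ ^ 2 = l ∧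
      M 1 0 * star (M 0 0) = M 1 1 * star (M 0 1) := by
  rw [← isSimilitude_conjTranspose_iff hl, isSimilitude_iff]
  simp only [Matrix.conjTranspose_apply, star_star, norm_star]

theorem IsSimilitude.of_mul_eq_one (hM : IsSimilitude M l) (hl : l ≠ 0) (hMN : M * N = 1) :
    IsSimilitude N l⁻¹ := by
  refine (eq_inv_smul_iff₀ hl).mpr ?_
  calc l • (Nᴴ * formH * N) = Nᴴ * (l • formH) * N := by
        rw [mul_smul_comm, smul_mul_assoc]
    _ = Nᴴ * (Mᴴ * formH * M) * N := congrArg (Nᴴ * · * N) hM.symm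
    _ = (M * N)ᴴ * formH * (M * N) := by rw [Matrix.conjTranspose_mul]; simp only [mul_assoc]
    _ = formH := by rw [hMN, Matrix.conjTranspose_one, one_mul, mul_one]

theorem IsSimilitude.smul (hM : IsSimilitude M l) (r : ℝ) : IsSimilitude (r • M) (r ^ 2 * l) := by
  have hstar : (r • M)ᴴ = r • Mᴴ := Matrix.ext fun i j => Quaternion.star_smul r (M j i)
  rw [IsSimilitude, hstar, smul_mul_assoc, smul_mul_assoc, mul_smul_comm, hM, smul_smul, smul_smul,
    sq]

theorem norm_mul_add_sq (p x y : ℍ[ℝ]) :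
    ‖p * x + y‖ ^ 2 = ‖x‖ ^ 2 * ‖p‖ ^ 2 + 2 * inner ℝ (y * star x) p + ‖y‖ ^ 2 := by
  have hinner : inner ℝ (p * x) y = inner ℝ (y * star x) p := by
    rw [real_inner_comm]
    simp only [Quaternion.inner_def, star_mul, mul_assoc]
  rw [norm_add_sq_real, norm_mul, mul_pow, mul_comm (‖p‖ ^ 2), hinner]

theorem norm_num_sq_sub_norm_denom_sq (M : Matrix (Fin 2) (Fin 2) ℍ[ℝ]) (p : ℍ[ℝ]) :
    ‖num M p‖ ^ 2 - ‖denom M p‖ ^ 2 = (‖M 0 0‖ ^ 2 - ‖M 0 1‖ ^ 2) * ‖p‖ ^ 2 +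
      2 * inner ℝ (M 1 0 * star (M 0 0) - M 1 1 * star (M 0 1)) p +
      (‖M 1 0‖ ^ 2 - ‖M 1 1‖ ^ 2) := by
  rw [num, denom, norm_mul_add_sq, norm_mul_add_sq, inner_sub_left]
  ring

theorem IsSimilitude.norm_num_sq_sub_norm_denom_sq (hM : IsSimilitude M l) (hl : l ≠ 0)
    (p : ℍ[ℝ]) : ‖num M p‖ ^ 2 - ‖denom M p‖ ^ 2 = l * (‖p‖ ^ 2 - 1) := by
  obtain ⟨h₀, h₁, h⟩ := (isSimilitude_iff_rows hl).mp hM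
  rw [RegularQuaternionic.norm_num_sq_sub_norm_denom_sq, h, sub_self, inner_zero_left, h₀,
    ← neg_sub (‖M 1 1‖ ^ 2), h₁]
  ring

theorem inv_mul_mem_unitBall_iff (hv : v ≠ 0) : v⁻¹ * w ∈ unitBall ↔ ‖w‖ < ‖v‖ := by
  rw [mem_unitBall_iff, norm_mul, norm_inv, inv_mul_lt_one₀ (norm_pos_iff.mpr hv)]

theorem IsSimilitude.norm_num_lt_norm_denom (hM : IsSimilitude M l) (hl : 0 < l)
    (hp : p ∈ unitBall) : ‖num M p‖ < ‖denom M p‖ := by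
  rw [mem_unitBall_iff, ← sq_lt_one_iff₀ (norm_nonneg p)] at hp
  refine lt_of_pow_lt_pow_left₀ 2 (norm_nonneg _) (sub_neg.mp ?_)
  rw [hM.norm_num_sq_sub_norm_denom_sq hl.ne']
  exact mul_neg_of_pos_of_neg hl (sub_neg.mpr hp)

theorem IsSimilitude.denom_ne_zero (hM : IsSimilitude M l) (hl : 0 < l) (hp : p ∈ unitBall) :
    denom M p ≠ 0 :=
  norm_pos_iff.mp ((norm_nonneg _).trans_lt (hM.norm_num_lt_norm_denom hl hp))

theorem IsSimilitude.mapsTo_frac (hM : IsSimilitude M l) (hl : 0 < l) :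
    Set.MapsTo (frac M) unitBall unitBall := fun _ hp =>
  (inv_mul_mem_unitBall_iff (hM.denom_ne_zero hl hp)).mpr (hM.norm_num_lt_norm_denom hl hp)

theorem IsSimilitude.image_frac (hM : IsSimilitude M l) (hl : 0 < l) :
    frac M '' unitBall = unitBall := by
  obtain ⟨N, hNM⟩ := (hM.isUnit hl.ne').exists_left_inv
  have hN : IsSimilitude N l⁻¹ := hM.of_mul_eq_one hl.ne' (mul_eq_one_comm.mp hNM)
  refine (hM.mapsTo_frac hl).image_subset.antisymm fun w hw =>
    ⟨frac N w, hN.mapsTo_frac (inv_pos.mpr hl) hw, ?_⟩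
  rw [← frac_mul (hN.denom_ne_zero (inv_pos.mpr hl) hw), hNM, frac_one]

theorem IsSimilitude.mapsBallOnto (hM : IsSimilitude M l) (hl : 0 < l) :
    MapsBallOnto (fracQuot M) :=
  (mapsBallOnto_fracQuot_iff fun _ => hM.denom_ne_zero hl).mpr (hM.image_frac hl)

theorem norm_lt_one_iff_of_mapsBallOnto (hM : IsUnit M) (h : MapsBallOnto (fracQuot M))
    (p : ℍ[ℝ]) : ‖p‖ < 1 ↔ ‖num M p‖ ^ 2 - ‖denom M p‖ ^ 2 < 0 := by
  have hdenom : ∀ p ∈ unitBall, denom M p ≠ 0 := fun p => denom_ne_zero_of_mapsBallOnto hM h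
  have himage := (mapsBallOnto_fracQuot_iff hdenom).mp h
  rw [← mem_unitBall_iff, sub_neg, pow_lt_pow_iff_left₀ (norm_nonneg _) (norm_nonneg _) two_ne_zero]
  constructor
  · intro hp
    exact (inv_mul_mem_unitBall_iff (hdenom p hp)).mp (himage.subset ⟨p, hp, rfl⟩)
  · intro hlt
    have hne : denom M p ≠ 0 := norm_pos_iff.mp ((norm_nonneg _).trans_lt hlt)
    obtain ⟨p', hp', hfrac⟩ := himage.superset ((inv_mul_mem_unitBall_iff hne).mpr hlt)
    exact injOn_frac hM (hdenom p' hp') hne hfrac ▸ hp'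

theorem exists_isSimilitude_of_mapsBallOnto (hM : IsUnit M) (h : MapsBallOnto (fracQuot M)) :
    ∃ l > 0, IsSimilitude M l := by
  have hiff := norm_lt_one_iff_of_mapsBallOnto hM h
  simp only [norm_num_sq_sub_norm_denom_sq] at hiff
  obtain ⟨hneg, hk, hm⟩ := eq_neg_and_eq_zero_of_norm_lt_one_iff hiff
  have hpos : 0 < ‖M 1 1‖ ^ 2 - ‖M 1 0‖ ^ 2 := by linarith
  exact ⟨_, hpos, (isSimilitude_iff_rows hpos.ne').mpr ⟨by linarith, rfl, sub_eq_zero.mp hm⟩⟩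

theorem IsSimilitude.norm_diag_eq (hM : IsSimilitude M l) (hl : l ≠ 0) : ‖M 0 0‖ = ‖M 1 1‖ := by
  obtain ⟨hrow, -, -⟩ := (isSimilitude_iff_rows hl).mp hM
  obtain ⟨-, hcol, -⟩ := isSimilitude_iff.mp hM
  exact (pow_left_inj₀ (norm_nonneg _) (norm_nonneg _) two_ne_zero).mp (by linarith)

theorem IsSimilitude.apply_one_one_ne_zero (hM : IsSimilitude M l) (hl : 0 < l) : M 1 1 ≠ 0 := by
  obtain ⟨-, hcol, -⟩ := isSimilitude_iff.mp hM
  intro hd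
  rw [hd, norm_zero] at hcol
  nlinarith

theorem IsSimilitude.dieudonneDet_eq (hM : IsSimilitude M l) (hl : 0 < l) :
    dieudonneDet M = l := by
  obtain ⟨hrow, -, horth⟩ := (isSimilitude_iff_rows hl.ne').mp hM
  have hnorm := hM.norm_diag_eq hl.ne'
  have hd := norm_ne_zero_iff.mpr (hM.apply_one_one_ne_zero hl)
  have ha : M 0 0 ≠ 0 := norm_ne_zero_iff.mp (hnorm ▸ hd)
  have hschur : M 1 0 * (M 0 0)⁻¹ * M 0 1 = (‖M 0 1‖ ^ 2 / ‖M 0 0‖ ^ 2) • M 1 1 := by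
    rw [Quaternion.inv_def, mul_smul_comm, horth, smul_mul_assoc, mul_assoc,
      star_mul_self_eq_coe_norm_sq, Quaternion.mul_coe_eq_smul, smul_smul,
      Quaternion.normSq_eq_norm_mul_self, ← sq, inv_mul_eq_div]
  have hdet : M 0 0 * M 1 1 - M 0 0 * M 1 0 * (M 0 0)⁻¹ * M 0 1 =
      (l / ‖M 0 0‖ ^ 2) • (M 0 0 * M 1 1) :=
    calc _ = M 0 0 * (M 1 1 - M 1 0 * (M 0 0)⁻¹ * M 0 1) := by
          simp only [mul_sub, mul_assoc]
      _ = M 0 0 * ((1 - ‖M 0 1‖ ^ 2 / ‖M 0 0‖ ^ 2) • M 1 1) := by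
          rw [hschur, sub_smul, one_smul]
      _ = (l / ‖M 0 0‖ ^ 2) • (M 0 0 * M 1 1) := by
          rw [mul_smul_comm, ← hrow, sub_div, div_self (by positivity)]
  rw [dieudonneDet, if_neg ha, hdet, norm_smul, norm_mul, ← hnorm, ← sq,
    Real.norm_of_nonneg (by positivity), div_mul_cancel₀ _ (by positivity)]

theorem mem_Sp11_iff_exists_isSimilitude {A : Matrix.GeneralLinearGroup (Fin 2) ℍ[ℝ]}
    (hA : A ∈ SL2) : A ∈ Sp11 ↔ ∃ l > 0, IsSimilitude A.1 l := by
  rw [mem_Sp11_iff]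
  refine ⟨fun h => ⟨1, one_pos, h⟩, fun ⟨l, hl, h⟩ => ?_⟩
  rwa [show l = 1 from (h.dieudonneDet_eq hl).symm.trans hA] at h

end Similitude

section Moebius

variable {M : Matrix (Fin 2) (Fin 2) ℍ[ℝ]} {l : ℝ} {a b p q u v : ℍ[ℝ]}

/-- The matrix whose regular fractional transformation is `(1 - q ā)^{-*} * (q - a) u`. -/
def moebiusMatrix (a u : ℍ[ℝ]) : Matrix (Fin 2) (Fin 2) ℍ[ℝ] := !![u, -star a; -(a * u), 1]

theorem moebius_eq_fracQuot (a u : ℍ[ℝ]) : moebius a u = fracQuot (moebiusMatrix a u) := by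
  have hdenom : 1 - ident * const (star a) = linear (-star a) 1 := by
    rw [linear, const_neg, const_one, mul_neg, sub_eq_neg_add]
  have hnum : (ident - const a) * const u = linear u (-(a * u)) := by
    rw [linear, const_neg, const_mul, sub_mul, sub_eq_add_neg]
  rw [moebius, hdenom, hnum]
  rfl

theorem num_moebiusMatrix (a u p : ℍ[ℝ]) : num (moebiusMatrix a u) p = (p - a) * u := by
  simp [num, moebiusMatrix, sub_mul, ← sub_eq_add_neg]

theorem denom_moebiusMatrix (a u p : ℍ[ℝ]) : denom (moebiusMatrix a u) p = 1 - p * star a := by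
  simp [denom, moebiusMatrix, sub_eq_neg_add]

theorem isSimilitude_moebiusMatrix (a : ℍ[ℝ]) (hu : ‖u‖ = 1) :
    IsSimilitude (moebiusMatrix a u) (1 - ‖a‖ ^ 2) := by
  refine isSimilitude_iff.mpr ⟨?_, ?_, ?_⟩ <;> simp [moebiusMatrix, hu]

theorem one_sub_norm_sq_pos (ha : a ∈ unitBall) : 0 < 1 - ‖a‖ ^ 2 :=
  sub_pos.mpr ((sq_lt_one_iff₀ (norm_nonneg a)).mpr (mem_unitBall_iff.mp ha))

theorem mapsBallOnto_moebius (hu : ‖u‖ = 1) (ha : a ∈ unitBall) : MapsBallOnto (moebius a u) :=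
  moebius_eq_fracQuot a u ▸
    (isSimilitude_moebiusMatrix a hu).mapsBallOnto (one_sub_norm_sq_pos ha)

theorem star_mul_mul_mul (x y z : ℍ[ℝ]) :
    star (z * x) * (z * y) = ‖z‖ ^ 2 • (star x * y) := by
  rw [star_mul, mul_assoc, ← mul_assoc (star z), star_mul_self_eq_coe_norm_sq,
    Quaternion.coe_mul_eq_smul, mul_smul_comm]

theorem eq_smul_moebiusMatrix (hd : M 1 1 ≠ 0) (h : star (M 0 1) * M 0 0 = star (M 1 1) * M 1 0) :
    M = M 1 1 • moebiusMatrix (-star ((M 1 1)⁻¹ * M 0 1)) ((M 1 1)⁻¹ * M 0 0) := by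
  have hb : star ((M 1 1)⁻¹ * M 0 1) * ((M 1 1)⁻¹ * M 0 0) = (M 1 1)⁻¹ * M 1 0 := by
    rw [star_mul_mul_mul, h, ← star_mul_mul_mul, inv_mul_cancel₀ hd, star_one, one_mul]
  rw [moebiusMatrix, neg_mul, neg_neg, hb, star_neg, star_star, neg_neg]
  ext i j : 1
  fin_cases i <;> fin_cases j <;> simp [mul_inv_cancel_left₀ hd]

theorem IsSimilitude.exists_fracQuot_eq_moebius (hM : IsSimilitude M l) (hl : 0 < l) :
    ∃ u a : ℍ[ℝ], ‖u‖ = 1 ∧ a ∈ unitBall ∧ fracQuot M = moebius a u := by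
  have hd := hM.apply_one_one_ne_zero hl
  obtain ⟨-, hcol, horth⟩ := isSimilitude_iff.mp hM
  refine ⟨(M 1 1)⁻¹ * M 0 0, -star ((M 1 1)⁻¹ * M 0 1), ?_, ?_, ?_⟩
  · rw [norm_mul, norm_inv, hM.norm_diag_eq hl.ne', inv_mul_cancel₀ (norm_ne_zero_iff.mpr hd)]
  · rw [mem_unitBall_iff, norm_neg, norm_star, ← mem_unitBall_iff, inv_mul_mem_unitBall_iff hd]
    exact lt_of_pow_lt_pow_left₀ 2 (norm_nonneg _) (by linarith)
  · rw [moebius_eq_fracQuot, ← fracQuot_smul hd (moebiusMatrix _ _),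
      ← eq_smul_moebiusMatrix hd horth]

theorem exists_mem_Sp11_regFrac_eq {A : Matrix.GeneralLinearGroup (Fin 2) ℍ[ℝ]} (hl : 0 < l)
    (hA : IsSimilitude A.1 l) : ∃ C ∈ Sp11, regFrac C = regFrac A := by
  obtain ⟨r, hr, hrl⟩ : ∃ r : ℝ, r ≠ 0 ∧ r ^ 2 * l = 1 :=
    ⟨(√l)⁻¹, inv_ne_zero (Real.sqrt_ne_zero'.mpr hl), by
      rw [inv_pow, Real.sq_sqrt hl.le, inv_mul_cancel₀ hl.ne']⟩
  have hsmul : r • A.1 = (r : ℍ[ℝ]) • A.1 :=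
    Matrix.ext fun i j => (Quaternion.coe_mul_eq_smul r (A.1 i j)).symm
  refine ⟨Units.mk0 r hr • A, mem_Sp11_iff.mpr (hrl ▸ hA.smul r), ?_⟩
  calc regFrac (Units.mk0 r hr • A) = fracQuot (r • A.1) := rfl
    _ = regFrac A := by
      rw [hsmul, fracQuot_smul (Quaternion.coe_injective.ne hr), regFrac_eq_fracQuot]

theorem denom_moebiusMatrix_ne_zero (hu : ‖u‖ = 1) (ha : a ∈ unitBall) :
    ∀ p ∈ unitBall, denom (moebiusMatrix a u) p ≠ 0 := fun _ =>
  (isSimilitude_moebiusMatrix a hu).denom_ne_zero (one_sub_norm_sq_pos ha)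

theorem hasValue_moebius (hu : ‖u‖ = 1) (ha : a ∈ unitBall) (hq : q ∈ unitBall) :
    HasValue (moebius a u) q (frac (moebiusMatrix a u) (twist (linear (-star a) 1) q)) :=
  moebius_eq_fracQuot a u ▸ hasValue_fracQuot (denom_moebiusMatrix_ne_zero hu ha) hq

/-- The value `1 - a ^ 2` of `fᶜ` at `a`, where `f(q) = 1 - q ā`, commutes with `a`. -/
theorem twist_linear_self (ha : a ∈ unitBall) : twist (linear (-star a) 1) a = a := by
  have hne := value_conj_linear_ne_zero (denom_moebiusMatrix_ne_zero norm_one ha) a ha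
  refine twist_eq_of_semiconjBy hne ?_
  rw [conj_linear, value_linear, star_neg, star_star, star_one]
  exact ((Commute.refl a).mul_left (Commute.refl a).neg_left).add_left (Commute.one_left a)

theorem frac_moebiusMatrix_eq_zero_iff (hu : ‖u‖ = 1) (ha : a ∈ unitBall) (hp : p ∈ unitBall) :
    frac (moebiusMatrix a u) p = 0 ↔ p = a := by
  have hu0 : u ≠ 0 := by
    rintro rfl
    simp at hu
  have hden := denom_moebiusMatrix_ne_zero hu ha p hp
  rw [frac, mul_eq_zero, or_iff_right (inv_ne_zero hden), num_moebiusMatrix, mul_eq_zero,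
    or_iff_left hu0, sub_eq_zero]

theorem hasValue_moebius_zero_iff (hu : ‖u‖ = 1) (ha : a ∈ unitBall) (hq : q ∈ unitBall) :
    HasValue (moebius a u) q 0 ↔ q = a := by
  have hden := denom_moebiusMatrix_ne_zero hu ha
  have hinj := injOn_twist_unitBall (value_linear_ne_zero hden) (value_conj_linear_ne_zero hden)
  have hvalue := hasValue_moebius hu ha hq
  have hp := twist_mem_unitBall (value_conj_linear_ne_zero hden) hq
  calc HasValue (moebius a u) q 0
      ↔ frac (moebiusMatrix a u) (twist (linear (-star a) 1) q) = 0 :=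
        ⟨hvalue.unique, fun h => h ▸ hvalue⟩
    _ ↔ twist (linear (-star a) 1) q = twist (linear (-star a) 1) a := by
        rw [twist_linear_self ha]
        exact frac_moebiusMatrix_eq_zero_iff hu ha hp
    _ ↔ q = a := hinj.eq_iff hq ha

theorem moebius_unit_unique (hu : ‖u‖ = 1) (hv : ‖v‖ = 1) (ha : a ∈ unitBall)
    (h : ∀ q ∈ unitBall, ∃ w, w ∈ toFun (moebius a u) q ∧ w ∈ toFun (moebius a v) q) : u = v := by
  have hden := denom_moebiusMatrix_ne_zero hu ha
  obtain ⟨p, hp, hpa⟩ : ∃ p ∈ unitBall, p ≠ a :=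
    (infinite_of_mem_nhds 0 (Metric.ball_mem_nhds 0 one_pos)).nontrivial.exists_ne a
  obtain ⟨q, hq, rfl⟩ := (image_twist_unitBall (value_linear_ne_zero hden)
    (value_conj_linear_ne_zero hden)).superset hp
  obtain ⟨w, hwu, hwv⟩ := h q hq
  have hfrac := ((hasValue_moebius hu ha hq).unique (mem_toFun.mp hwu)).trans
    ((mem_toFun.mp hwv).unique (hasValue_moebius hv ha hq))
  rw [frac, frac, denom_moebiusMatrix a u, denom_moebiusMatrix a v, num_moebiusMatrix,
    num_moebiusMatrix] at hfrac
  have hnum := mul_left_cancel₀ (inv_ne_zero (denom_moebiusMatrix a u _ ▸ hden _ hp)) hfrac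
  exact mul_left_cancel₀ (sub_ne_zero.mpr hpa) hnum

theorem moebius_params_unique (hu : ‖u‖ = 1) (hv : ‖v‖ = 1) (ha : a ∈ unitBall) (hb : b ∈ unitBall)
    (h : ∀ q ∈ unitBall, ∃ w, w ∈ toFun (moebius a u) q ∧ w ∈ toFun (moebius b v) q) :
    u = v ∧ a = b := by
  obtain ⟨w, hwa, hwb⟩ := h a ha
  have hw : w = 0 := (mem_toFun.mp hwa).unique ((hasValue_moebius_zero_iff hu ha ha).mpr rfl)
  obtain rfl : a = b := (hasValue_moebius_zero_iff hv hb ha).mp (mem_toFun.mp (hw ▸ hwb))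
  exact ⟨moebius_unit_unique hu hv ha h, rfl⟩

theorem IsSimilitude.existsUnique_moebius (hM : IsSimilitude M l) (hl : 0 < l) :
    ∃! p : ℍ[ℝ] × ℍ[ℝ], ‖p.1‖ = 1 ∧ p.2 ∈ unitBall ∧
      ∀ q ∈ unitBall, ∃ w, w ∈ toFun (fracQuot M) q ∧ w ∈ toFun (moebius p.2 p.1) q := by
  obtain ⟨u, a, hu, ha, hM'⟩ := hM.exists_fracQuot_eq_moebius hl
  rw [hM']
  refine ⟨(u, a), ⟨hu, ha, fun q hq => ?_⟩, fun ⟨v, b⟩ ⟨hv, hb, h⟩ => ?_⟩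
  · have hw := mem_toFun.mpr (hasValue_moebius hu ha hq)
    exact ⟨_, hw, hw⟩
  · obtain ⟨rfl, rfl⟩ := moebius_params_unique hu hv ha hb h
    rfl

theorem regMoebius_eq_orbit : regMoebius = orbit (toQuot ident) Sp11 := by
  ext φ
  constructor
  · rintro ⟨⟨A, rfl⟩, h⟩
    obtain ⟨l, hl, hA⟩ := exists_isSimilitude_of_mapsBallOnto A.isUnit h
    obtain ⟨C, hC, hCA⟩ := exists_mem_Sp11_regFrac_eq hl hA
    exact ⟨C, hC, by rw [act_ident, hCA]⟩
  · rintro ⟨A, hA, rfl⟩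
    rw [act_ident]
    exact ⟨⟨A, rfl⟩, (mem_Sp11_iff.mp hA).mapsBallOnto one_pos⟩

end Moebius

end RegularQuaternionic

end

theorem mainTheorem6_general (A : Matrix.GeneralLinearGroup (Fin 2) ℍ[ℝ]) :
    List.TFAE
      [MapsBallOnto (regFrac A),
        ∃ l > 0, IsSimilitude A.1 l,
        ∃ u a : ℍ[ℝ], ‖u‖ = 1 ∧ a ∈ unitBall ∧
          ∀ q ∈ unitBall, ∃ w, w ∈ toFun (regFrac A) q ∧ w ∈ toFun (moebius a u) q,
        ∃! p : ℍ[ℝ] × ℍ[ℝ], ‖p.1‖ = 1 ∧ p.2 ∈ unitBall ∧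
          ∀ q ∈ unitBall, ∃ w, w ∈ toFun (regFrac A) q ∧ w ∈ toFun (moebius p.2 p.1) q] := by
  tfae_have 1 → 2 := exists_isSimilitude_of_mapsBallOnto A.isUnit
  tfae_have 2 → 4 := fun ⟨_, hl, hA⟩ => hA.existsUnique_moebius hl
  tfae_have 4 → 3 := fun ⟨p, ⟨hu, ha, h⟩, _⟩ => ⟨p.1, p.2, hu, ha, h⟩
  tfae_have 3 → 1 := fun ⟨_, _, hu, ha, h⟩ => (mapsBallOnto_moebius hu ha).congr h
  tfae_finish

theorem mainTheorem6 :
    (∀ A ∈ SL2,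
      List.TFAE
        [MapsBallOnto (regFrac A),
          A ∈ Sp11,
          ∃ u a : ℍ[ℝ], ‖u‖ = 1 ∧ a ∈ unitBall ∧
            ∀ q ∈ unitBall, ∃ w, w ∈ toFun (regFrac A) q ∧ w ∈ toFun (moebius a u) q,
          ∃! p : ℍ[ℝ] × ℍ[ℝ], ‖p.1‖ = 1 ∧ p.2 ∈ unitBall ∧
            ∀ q ∈ unitBall, ∃ w, w ∈ toFun (regFrac A) q ∧ w ∈ toFun (moebius p.2 p.1) q]) ∧
    regMoebius = orbit (toQuot ident) Sp11 :=
  ⟨fun A hA => by simpa only [mem_Sp11_iff_exists_isSimilitude hA] using mainTheorem6_general A,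
    regMoebius_eq_orbit⟩
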